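/- A housing market consists of a finite set $N$ of agents, where agent $i\in N$ is endowed with object $i$ (so $N$ is also the set of objects), and a profile $R=(R_i)_{i\in N}$ of complete and transitive preferences over $N$ (ties allowed); $P_i$ and $I_i$ denote the strict part and the indifference part of $R_i$. Object $k$ is acceptable to $j$ at $R$ if $k\,R_j\,j$. An allocation is a vector $x=(x_i)_{i\in N}\in N^N$ with $\bigcup_{i\in N}\{x_i\}=N$. It is competitive at $R$ if there are prices $p\in\mathbb{R}^N$ such that for each $i\in N$, $p_{x_i}\le p_i$, and for all $i,j\in N$, $j\,P_i\,x_i$ implies $p_j>p_i$. Let $\mathcal{T}(R)$ be the set of competitive allocations at $R$. For $i\in N$ and profiles $R,\tilde R$, say that $\tilde R$ is an improvement for $i$ with respect to $R$ if 1. $\tilde R_i=R_i$; 2. for all $j\ne i$ and all $k$ with $k\,R_j\,j$: $i\,I_j\,k$ implies $i\,\tilde R_j\,k$, and $i\,P_j\,k$ implies $i\,\tilde P_j\,k$; 3. for all $j\neq i$ and all $k,l\ne i$ with $k\,R_j\,j$ and $l\,R_j\,j$: $k\,R_j\,l$ if and only if $k\,\tilde R_j\,l$; and 4. for all $j\ne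 i$ and all $k\neq i$: if $k$ is not acceptable to $j$ at $R$, then $k$ is not acceptable to $j$ at $\tilde R$. Proposition. Let $i\in N$ and let $\tilde R$ be an improvement for $i$ with respect to $R$. Then - there is $\tilde x\in\mathcal{T}(\tilde R)$ such that for each $x\in\mathcal{T}(R)$, $\tilde x_i\,R_i\,x_i$; and - there is $x\in\mathcal{T}(R)$ such that for each $\tilde x\in\mathcal{T}(\tilde R)$, $\tilde x_i\,R_i\,x_i$. That is, $i$ weakly prefers her best (respectively worst) allotment over all competitive allocations at $\tilde R$ to her best (respectively worst) allotment over all competitive allocations at $R$. -/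

import Mathlib

namespace HousingMarket

/-- Complete and transitive (weak) preferences over the set `N` of objects;
`r.weak j k` means that `j` is weakly preferred to `k`. -/
structure Preference (N : Type*) where
  weak : N → N → Prop
  complete : ∀ j k, weak j k ∨ weak k j
  transitive : ∀ j k l, weak j k → weak k l → weak j l

namespace Preference

variable {N : Type*}

/-- The strict part of a preference. -/
def strict (r : Preference N) (j k : N) : Prop :=
  r.weak j k ∧ ¬ r.weak k j

/-- The indifference part of a preference. -/
def indiff (r : Preference N) (j k : N) : Prop :=
  r.weak j k ∧ r.weak k j

end Preference

/-- A preference profile: one preference over the objects for each agent. Agents and objects are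
both indexed by `N`; agent `i` is endowed with object `i`. -/
abbrev Profile (N : Type*) := N → Preference N

section

variable {N : Type*}

/-- Object `j` is acceptable to agent `i`: it is weakly preferred to the own object of `i`. -/
def Acceptable (R : Profile N) (i j : N) : Prop :=
  (R i).weak j i

/-- An allocation: a vector of allotments `x i` in which the objects are redistributed, that is,
the union of the sets `{x i}` is the set of all objects. -/
def IsAllocation (x : N → N) : Prop :=
  (⋃ i, {x i}) = (Set.univ : Set N)

/-- Competitive equilibrium: `x` is an allocation, every agent can afford her allotment, and no
agent can afford an object that she strictly prefers to her allotment. -/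
structure IsCompetitiveEquilibrium (R : Profile N) (x : N → N) (p : N → ℝ) : Prop where
  isAllocation : IsAllocation x
  affordable : ∀ i, p (x i) ≤ p i
  not_affordable : ∀ i j, (R i).strict j (x i) → p i < p j

/-- The set of competitive allocations. -/
def competitiveAllocations (R : Profile N) : Set (N → N) :=
  {x | ∃ p : N → ℝ, IsCompetitiveEquilibrium R x p}

/-- `R'` is an improvement for agent `i` with respect to `R`. -/
structure IsImprovement (i : N) (R R' : Profile N) : Prop where
  /-- The preferences of `i` do not change. -/
  same : R' i = R i
  /-- For the other agents, object `i` does not fall behind an acceptable object which it tied. -/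
  up_indiff : ∀ j, j ≠ i → ∀ k, Acceptable R j k → (R j).indiff i k → (R' j).weak i k
  /-- For the other agents, object `i` stays above the acceptable objects which it beat. -/
  up_strict : ∀ j, j ≠ i → ∀ k, Acceptable R j k → (R j).strict i k → (R' j).strict i k
  /-- The comparison of acceptable objects different from `i` does not change. -/
  others : ∀ j, j ≠ i → ∀ k, k ≠ i → ∀ l, l ≠ i → Acceptable R j k → Acceptable R j l →
    ((R j).weak k l ↔ (R' j).weak k l)
  /-- Unacceptable objects different from `i` remain unacceptable. -/
  unacceptable : ∀ j, j ≠ i → ∀ k, k ≠ i → ¬ Acceptable R j k → ¬ Acceptable R' j k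

end

end HousingMarket

namespace HousingMarket

namespace Preference

variable {N : Type*}

/-! Breaking ties reduces the claim to strict preferences: each equilibrium survives a suitable
tie-breaking, and equilibria of a broken profile are equilibria of the original. Breaking `R` and
`R'` alike, `weak_allotment_of_breakTies` compares any two equilibria; existence (top trading
cycles) supplies the missing one. If `i` lost, trade along `x` would raise `p'` at `i`. Since `x`
permutes each level of `p`, and `x'` each level of `p'`, every rise forces a fall elsewhere on the
level (`exists_descent`). Alternating the two yields falls of `p'` at ever higher `p`, contradicting
finiteness. -/

theorem weak_refl (r : Preference N) (a : N) : r.weak a a := (r.complete a a).elim id id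

theorem weak_of_not_weak (r : Preference N) {a b : N} (h : ¬ r.weak a b) : r.weak b a :=
  (r.complete a b).resolve_left h

theorem strict_of_not_weak (r : Preference N) {a b : N} (h : ¬ r.weak a b) : r.strict b a :=
  ⟨r.weak_of_not_weak h, h⟩

theorem weak_of_not_strict (r : Preference N) {a b : N} (h : ¬ r.strict a b) : r.weak b a :=
  by_contra fun hn => h (r.strict_of_not_weak hn)

/-- The preference `r` with ties resolved in favour of the objects with the lower value of `t`. -/
def breakTies (r : Preference N) (t : N → ℕ) : Preference N where
  weak a b := r.weak a b ∧ (r.weak b a → t a ≤ t b)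
  complete a b := by
    by_cases hab : r.weak a b
    · by_cases hba : r.weak b a
      · exact (le_total (t a) (t b)).imp (fun h => ⟨hab, fun _ => h⟩) (fun h => ⟨hba, fun _ => h⟩)
      · exact Or.inl ⟨hab, fun h => absurd h hba⟩
    · exact Or.inr ⟨r.weak_of_not_weak hab, fun h => absurd h hab⟩
  transitive a b c hab hbc :=
    ⟨r.transitive a b c hab.1 hbc.1, fun hca =>
      (hab.2 (r.transitive b c a hbc.1 hca)).trans (hbc.2 (r.transitive c a b hca hab.1))⟩

theorem breakTies_antisymm (r : Preference N) {t : N → ℕ} (ht : Function.Injective t) {a b : N}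
    (hab : (r.breakTies t).weak a b) (hba : (r.breakTies t).weak b a) : a = b :=
  ht (le_antisymm (hab.2 hba.1) (hba.2 hab.1))

theorem strict_breakTies_of_strict (r : Preference N) (t : N → ℕ) {a b : N} (h : r.strict a b) :
    (r.breakTies t).strict a b :=
  ⟨⟨h.1, fun hba => absurd hba h.2⟩, fun hba => h.2 hba.1⟩

/-- In a finite nonempty set there is an object that is at least as good as all the others. -/
theorem exists_best (r : Preference N) {A : Finset N} (hA : A.Nonempty) :
    ∃ a ∈ A, ∀ b ∈ A, r.weak a b := by
  classical
  induction hA using Finset.Nonempty.cons_induction with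
  | singleton a => exact ⟨a, by simp, by simpa using r.weak_refl a⟩
  | cons c s hc hs ih =>
    obtain ⟨a, ha, hbest⟩ := ih
    rcases r.complete a c with h | h
    · exact ⟨a, by simp [ha], by simpa using ⟨h, hbest⟩⟩
    · exact ⟨c, by simp, by
        simpa using ⟨r.weak_refl c, fun b hb => r.transitive _ _ _ h (hbest b hb)⟩⟩

/-- The reversed preference. -/
def reverse (r : Preference N) : Preference N where
  weak a b := r.weak b a
  complete a b := r.complete b a
  transitive a b c hab hbc := r.transitive c b a hbc hab

end Preference

section

variable {N : Type*}

/-! ### Equilibria and tie-breaking -/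

theorem IsAllocation.surjective {x : N → N} (h : IsAllocation x) : Function.Surjective x := by
  intro a
  have : a ∈ ⋃ i, ({x i} : Set N) := h ▸ Set.mem_univ a
  obtain ⟨i, hi⟩ := Set.mem_iUnion.1 this
  exact ⟨i, (Set.mem_singleton_iff.1 hi).symm⟩

theorem isAllocation_of_surjective {x : N → N} (h : Function.Surjective x) : IsAllocation x := by
  refine Set.eq_univ_of_forall fun a => ?_
  obtain ⟨i, hi⟩ := h a
  exact Set.mem_iUnion.2 ⟨i, hi.symm⟩

namespace IsCompetitiveEquilibrium

variable {R : Profile N} {x : N → N} {p : N → ℝ}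

theorem injective [Finite N] (h : IsCompetitiveEquilibrium R x p) : Function.Injective x :=
  Finite.injective_iff_surjective.2 h.isAllocation.surjective

/-- Total value is preserved by the permutation `x`, so no budget inequality can be slack. -/
theorem price_eq [Finite N] (h : IsCompetitiveEquilibrium R x p) (j : N) : p (x j) = p j := by
  have := Fintype.ofFinite N
  have hsum : ∑ i, p (x i) = ∑ i, p i :=
    (Equiv.ofBijective x ⟨h.injective, h.isAllocation.surjective⟩).sum_comp p
  exact (Finset.sum_eq_sum_iff_of_le fun i _ => h.affordable i).1 hsum j (Finset.mem_univ j)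

theorem weak_of_price_le (h : IsCompetitiveEquilibrium R x p) {i j : N} (hp : p j ≤ p i) :
    (R i).weak (x i) j :=
  (R i).weak_of_not_strict fun hs => (h.not_affordable i j hs).not_ge hp

theorem acceptable (h : IsCompetitiveEquilibrium R x p) (i : N) : Acceptable R i (x i) :=
  h.weak_of_price_le le_rfl

/-- A competitive equilibrium remains one when the ties are kept that were broken. -/
theorem of_breakTies {t : N → N → ℕ}
    (h : IsCompetitiveEquilibrium (fun j => (R j).breakTies (t j)) x p) :
    IsCompetitiveEquilibrium R x p :=
  ⟨h.isAllocation, h.affordable, fun i j hs =>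
    h.not_affordable i j ((R i).strict_breakTies_of_strict (t i) hs)⟩

/-- Ties can be broken so that a given competitive equilibrium is preserved. -/
theorem exists_breakTies [Finite N] (h : IsCompetitiveEquilibrium R x p) :
    ∃ t : N → N → ℕ, (∀ j, Function.Injective (t j)) ∧
      IsCompetitiveEquilibrium (fun j => (R j).breakTies (t j)) x p := by
  classical
  obtain ⟨e, he⟩ := exists_injective_nat N
  -- Each agent ranks her own allotment first among its ties; the shift by one reserves rank 0 for
  -- it.
  refine ⟨fun j a => if a = x j then 0 else e a + 1, fun j a b hab => ?_,
    h.isAllocation, h.affordable, fun i j hs => h.not_affordable i j ⟨hs.1.1, fun hw => ?_⟩⟩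
  · dsimp only at hab
    split_ifs at hab with ha hb hb
    · rw [ha, hb]
    · exact he (by omega)
  · exact hs.2 ⟨hw, fun _ => by simp⟩

end IsCompetitiveEquilibrium

/-! ### Existence of equilibria and extremal allotments -/

/-- A self-map of a nonempty finite set permutes some nonempty subset. -/
theorem exists_image_eq_self [DecidableEq N] (f : N → N) {A : Finset N} (hA : A.Nonempty)
    (hf : A.image f ⊆ A) : ∃ C ⊆ A, C.Nonempty ∧ C.image f = C := by
  induction A using Finset.strongInduction with
  | H A ih =>
    by_cases h : A.image f = A
    · exact ⟨A, subset_rfl, hA, h⟩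
    · obtain ⟨C, hC, hne, hfC⟩ := ih _ (hf.ssubset_of_ne h) (hA.image f)
        (Finset.image_subset_image hf)
      exact ⟨C, hC.trans hf, hne, hfC⟩

/-- Top trading cycles: the market restricted to a finite set of agents has an equilibrium. -/
theorem exists_equilibrium_on [DecidableEq N] (R : Profile N) (A : Finset N) :
    ∃ (x : N → N) (p : N → ℕ), A.image x = A ∧ (∀ j ∈ A, p (x j) = p j) ∧
      (∀ j ∈ A, p j ≤ A.card) ∧ ∀ j ∈ A, ∀ k ∈ A, (R j).strict k (x j) → p j < p k := by
  induction A using Finset.strongInduction with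
  | H A ih =>
    rcases A.eq_empty_or_nonempty with rfl | hA
    · exact ⟨id, fun _ => 0, by simp⟩
    choose f hfA hf using fun j => (R j).exists_best hA
    obtain ⟨C, hCA, hC, hfC⟩ := exists_image_eq_self f hA
      (Finset.image_subset_iff.2 fun j _ => hfA j)
    have hlt : A \ C ⊂ A := Finset.sdiff_ssubset hCA hC
    obtain ⟨y, q, hy, hqy, hq, hyq⟩ := ih _ hlt
    have hcard : (A \ C).card < A.card := Finset.card_lt_card hlt
    have hfmem : ∀ j ∈ C, f j ∈ C := fun j hj => hfC ▸ Finset.mem_image_of_mem f hj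
    have hymem : ∀ j ∈ A \ C, y j ∈ A \ C := fun j hj => hy ▸ Finset.mem_image_of_mem y hj
    -- Agents in `C` trade their favourites at price `A.card`, above every price in the rest of the
    -- market; hence the price bound in the induction.
    refine ⟨fun j => if j ∈ C then f j else y j, fun j => if j ∈ C then A.card else q j,
      ?_, ?_, ?_, ?_⟩
    · refine subset_antisymm (Finset.image_subset_iff.2 fun j hj => ?_) fun k hk => ?_
      · by_cases hjC : j ∈ C
        · simpa [hjC] using hfA j
        · simpa [hjC] using (Finset.mem_sdiff.1 (hymem j (by simp [hj, hjC]))).1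
      · by_cases hkC : k ∈ C
        · obtain ⟨j, hj, rfl⟩ := Finset.mem_image.1 (hfC.symm ▸ hkC)
          exact Finset.mem_image.2 ⟨j, hCA hj, by simp [hj]⟩
        · have hk' : k ∈ (A \ C).image y := hy.symm ▸ Finset.mem_sdiff.2 ⟨hk, hkC⟩
          obtain ⟨j, hj, rfl⟩ := Finset.mem_image.1 hk'
          exact Finset.mem_image.2
            ⟨j, (Finset.mem_sdiff.1 hj).1, by simp [(Finset.mem_sdiff.1 hj).2]⟩
    · intro j hj
      by_cases hjC : j ∈ C
      · simp [hjC, hfmem j hjC]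
      · have hjA : j ∈ A \ C := by simp [hj, hjC]
        simp [hjC, (Finset.mem_sdiff.1 (hymem j hjA)).2, hqy j hjA]
    · intro j hj
      by_cases hjC : j ∈ C
      · simp [hjC]
      · simpa [hjC] using (hq j (by simp [hj, hjC])).trans hcard.le
    · intro j hj k hk hs
      by_cases hjC : j ∈ C
      · simp only [hjC, if_true] at hs
        exact absurd (hf j k hk) hs.2
      · have hjA : j ∈ A \ C := by simp [hj, hjC]
        by_cases hkC : k ∈ C
        · simpa [hjC, hkC] using (hq j hjA).trans_lt hcard
        · simp only [hjC, if_false] at hs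
          simpa [hjC, hkC] using hyq j hjA k (by simp [hk, hkC]) hs

theorem competitiveAllocations_nonempty [Finite N] (R : Profile N) :
    (competitiveAllocations R).Nonempty := by
  classical
  have := Fintype.ofFinite N
  obtain ⟨x, p, hx, hp, -, hs⟩ := exists_equilibrium_on R Finset.univ
  refine ⟨x, fun j => p j, isAllocation_of_surjective fun a => by simpa using hx.ge (Finset.mem_univ a),
    fun j => ?_, fun j k h => ?_⟩
  · exact_mod_cast (hp j (Finset.mem_univ j)).le
  · exact_mod_cast hs j (Finset.mem_univ j) k (Finset.mem_univ k) h

/-- The preference `r` is arbitrary so that the reversed one gives a worst allotment. -/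
theorem exists_best_allotment [Finite N] (R : Profile N) (r : Preference N) (i : N) :
    ∃ x ∈ competitiveAllocations R, ∀ y ∈ competitiveAllocations R, r.weak (x i) (y i) := by
  classical
  have := Fintype.ofFinite N
  let A : Finset N := {a | ∃ x ∈ competitiveAllocations R, x i = a}
  have hA : A.Nonempty := by
    obtain ⟨x, hx⟩ := competitiveAllocations_nonempty R
    exact ⟨x i, by simpa [A] using ⟨x, hx, rfl⟩⟩
  obtain ⟨a, ha, hbest⟩ := r.exists_best hA
  obtain ⟨x, hx, rfl⟩ := (Finset.mem_filter.1 ha).2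
  exact ⟨x, hx, fun y hy => hbest _ (by simpa [A] using ⟨y, hy, rfl⟩)⟩

/-- If an injective map `f` of a finite set preserves `p` and raises `q` at `j`, then it lowers
`q` somewhere at the level of `p` of `j`, and at a point where `q` is above its value at `j`. -/
theorem exists_descent [Finite N] {f : N → N} (hf : Function.Injective f) {p q : N → ℝ}
    (hp : ∀ k, p (f k) = p k) {j : N} (hj : q j < q (f j)) :
    ∃ m, p m = p j ∧ q j < q m ∧ q (f m) < q m := by
  by_contra! hn
  -- Without a fall, this finite set is mapped onto itself; it contains `f j`, whose only preimage
  -- `j` lies outside.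
  have hmaps : Set.MapsTo f {k | p k = p j ∧ q j < q k} {k | p k = p j ∧ q j < q k} :=
    fun k hk => ⟨(hp k).trans hk.1, hk.2.trans_le (hn k hk.1 hk.2)⟩
  obtain ⟨a, ha, hfa⟩ := ((Set.toFinite _).injOn_iff_bijOn_of_mapsTo hmaps).1 hf.injOn |>.surjOn ⟨hp j, hj⟩
  exact lt_irrefl _ (hf hfa ▸ ha.2)

/-! ### Comparing equilibria before and after an improvement -/

namespace IsImprovement

variable {i : N} {R R' : Profile N}

/-- An improvement of `i` does not raise another object, whatever way ties are broken. -/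
theorem weak_breakTies (h : IsImprovement i R R') (t : N → ℕ) {j a b : N} (hj : j ≠ i)
    (ha : a ≠ i) (haj : Acceptable R j a) (hbj : Acceptable R j b)
    (hab : ((R' j).breakTies t).weak a b) : ((R j).breakTies t).weak a b := by
  by_cases hb : b = i
  · subst hb
    have hw : (R j).weak a b :=
      (R j).weak_of_not_strict fun hs => (h.up_strict j hj a haj hs).2 hab.1
    exact ⟨hw, fun hba => hab.2 (h.up_indiff j hj a haj ⟨hba, hw⟩)⟩
  · exact ⟨(h.others j hj a ha b hb haj hbj).2 hab.1,
      fun hba => hab.2 ((h.others j hj b hb a ha hbj haj).1 hba)⟩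

/-- Strict preferences: when ties are broken in the same way before and after an improvement of
`i`, then `i` gains weakly. -/
theorem weak_allotment_of_breakTies [Finite N] (h : IsImprovement i R R') {t : N → N → ℕ}
    (ht : ∀ j, Function.Injective (t j)) {x x' : N → N} {p p' : N → ℝ}
    (hx : IsCompetitiveEquilibrium (fun j => (R j).breakTies (t j)) x p)
    (hx' : IsCompetitiveEquilibrium (fun j => (R' j).breakTies (t j)) x' p') :
    (R i).weak (x' i) (x i) := by
  by_contra hn
  have hstrict : (R' i).strict (x i) (x' i) := h.same ▸ (R i).strict_of_not_weak hn
  -- At agents richer than `i` under `p'`, equilibrium comparisons carry over from `R'` to `R`.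
  have key : ∀ j, p' i < p' j → ((R' j).breakTies (t j)).weak (x' j) (x j) →
      ((R j).breakTies (t j)).weak (x' j) (x j) := by
    intro j hj hw
    -- Object `i` is too cheap at `p'` to be the allotment of `j`.
    have hne : x' j ≠ i := fun he => by
      have := hx'.price_eq j
      rw [he] at this
      exact hj.ne this
    have hji : j ≠ i := fun he => hj.ne (by rw [he])
    exact h.weak_breakTies (t j) hji hne
      (by_contra fun hna => h.unacceptable j hji _ hne hna (hx'.acceptable j).1)
      (hx.acceptable j).1 hw
  have start : ∃ j, p' i < p' j ∧ p' (x j) < p' j := by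
    obtain ⟨j, -, hj⟩ := exists_descent hx.injective hx.price_eq
      (hx'.of_breakTies.not_affordable i (x i) hstrict)
    exact ⟨j, hj⟩
  -- Among the falls of `p'` along `x` above the wealth of `i`, take one with maximal `p`.
  obtain ⟨j, ⟨hij, hj⟩, hmax⟩ :=
    (Set.toFinite {j | p' i < p' j ∧ p' (x j) < p' j}).exists_maximalFor p _ start
  -- At `p'` agent `j` can afford `x j` yet holds another object, so she strictly prefers `x' j`,
  -- also at `R`.
  have hgain : p j < p (x' j) := by
    have hw := key j hij (hx'.weak_of_price_le hj.le)
    refine hx.not_affordable j (x' j) ⟨hw, fun hw' => ?_⟩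
    have heq := (R j).breakTies_antisymm (ht j) hw hw'
    exact hj.ne (heq ▸ hx'.price_eq j)
  obtain ⟨m, hm', hjm, hm⟩ := exists_descent hx'.injective hx'.price_eq hgain
  -- At `p` agent `m` can afford `x' m`; were it weakly better at `R'`, the two allotments would
  -- coincide.
  have hgain' : p' m < p' (x m) := by
    refine hx'.not_affordable m (x m) (Preference.strict_of_not_weak _ fun hw => ?_)
    have heq := (R m).breakTies_antisymm (ht m) (key m (hm' ▸ hij) hw)
      (hx.weak_of_price_le hm.le)
    exact hm.ne (heq ▸ hx.price_eq m)
  obtain ⟨k, hk, hmk, hk'⟩ := exists_descent hx.injective hx.price_eq hgain'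
  have hjk : p j < p k := hk ▸ hjm
  exact (hmax ⟨(hm' ▸ hij).trans hmk, hk'⟩ hjk.le).not_gt hjk

theorem exists_better_allotment [Finite N] (h : IsImprovement i R R') {x : N → N}
    (hx : x ∈ competitiveAllocations R) :
    ∃ x' ∈ competitiveAllocations R', (R i).weak (x' i) (x i) := by
  obtain ⟨p, hx⟩ := hx
  obtain ⟨t, ht, hxt⟩ := hx.exists_breakTies
  obtain ⟨x', p', hx'⟩ := competitiveAllocations_nonempty fun j => (R' j).breakTies (t j)
  exact ⟨x', ⟨p', hx'.of_breakTies⟩, h.weak_allotment_of_breakTies ht hxt hx'⟩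

theorem exists_worse_allotment [Finite N] (h : IsImprovement i R R') {x' : N → N}
    (hx' : x' ∈ competitiveAllocations R') :
    ∃ x ∈ competitiveAllocations R, (R i).weak (x' i) (x i) := by
  obtain ⟨p', hx'⟩ := hx'
  obtain ⟨t, ht, hxt'⟩ := hx'.exists_breakTies
  obtain ⟨x, p, hx⟩ := competitiveAllocations_nonempty fun j => (R j).breakTies (t j)
  exact ⟨x, ⟨p, hx.of_breakTies⟩, h.weak_allotment_of_breakTies ht hx hxt'⟩

end IsImprovement

end

end HousingMarket

theorem proposition1 {N : Type*} [Finite N] (i : N) (R R' : HousingMarket.Profile N)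
    (h : HousingMarket.IsImprovement i R R') :
    (∃ x' ∈ HousingMarket.competitiveAllocations R',
      ∀ x ∈ HousingMarket.competitiveAllocations R, (R i).weak (x' i) (x i)) ∧
    (∃ x ∈ HousingMarket.competitiveAllocations R,
      ∀ x' ∈ HousingMarket.competitiveAllocations R', (R i).weak (x' i) (x i)) := by
  constructor
  · obtain ⟨x', hx', hbest⟩ := HousingMarket.exists_best_allotment R' (R i) i
    refine ⟨x', hx', fun x hx => ?_⟩
    obtain ⟨y, hy, hyx⟩ := h.exists_better_allotment hx
    exact (R i).transitive _ _ _ (hbest y hy) hyx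
  · obtain ⟨x, hx, hworst⟩ := HousingMarket.exists_best_allotment R (R i).reverse i
    refine ⟨x, hx, fun x' hx' => ?_⟩
    obtain ⟨y, hy, hxy⟩ := h.exists_worse_allotment hx'
    exact (R i).transitive _ _ _ hxy (hworst y hy)
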